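/- Let $K$ be a field and let $\mathcal S$ be a numerical semigroup of embedding dimension three, that is, a submonoid of $\mathbb N$ whose (unique) minimal generating set $A=\{a_1,a_2,a_3\}$ consists of three distinct positive integers with $\gcd(a_1,a_2,a_3)=1$. For $\mathbf u\in\mathbb N^3$ put $\deg_A(\mathbf x^{\mathbf u})=u_1a_1+u_2a_2+u_3a_3$, and let $$I_A=\langle \mathbf x^{\mathbf u}-\mathbf x^{\mathbf v} \mid \deg_A(\mathbf x^{\mathbf u})=\deg_A(\mathbf x^{\mathbf v})\rangle\subseteq K[x_1,x_2,x_3]$$ be the toric ideal of $A$. A circuit of $I_A$ is a binomial $\mathbf x^{\mathbf u}-\mathbf x^{\mathbf v}\in I_A$ such that $\operatorname{supp}(\mathbf u)\cap\operatorname{supp}(\mathbf v)=\emptyset$, the nonzero entries of $\mathbf u+\mathbf v$ are relatively prime, and there is no nonzero binomial $\mathbf x^{\mathbf u'}-\mathbf x^{\mathbf v'}\in I_A$ with $\operatorname{supp}(\mathbf u')\cup\operatorname{supp}(\mathbf v')\subsetneq\operatorname{supp}(\mathbf u)\cup\operatorname{supp}(\mathbf v)$. Then $I_A$ is generated (as an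 ideal) by its set of circuits if and only if there exist pairwise coprime positive integers $d_1,d_2,d_3$ and positive integers $f_2,f_3$ with $\gcd(d_2,f_2)=\gcd(d_3,f_3)=1$ such that $\mathcal S$ is minimally generated by $\{d_2d_3,\ f_2d_1d_3,\ f_3d_1d_2\}$. -/

import Mathlib

open MvPolynomial

/-- A numerical semigroup: a submonoid of `ℕ` generated by a finite set of relatively prime
positive integers. -/
def IsNumericalSemigroup (S : AddSubmonoid ℕ) : Prop :=
  ∃ A : Finset ℕ, (∀ a ∈ A, 0 < a) ∧ A.gcd id = 1 ∧ AddSubmonoid.closure (A : Set ℕ) = S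

/-- `A` is a generating set of the monoid `S` that is minimal with respect to inclusion. -/
def MinimallyGenerates (A : Set ℕ) (S : AddSubmonoid ℕ) : Prop :=
  Minimal (fun B : Set ℕ => AddSubmonoid.closure B = S) A

/-- The pure difference binomial `x^u - x^v`. -/
noncomputable def pureBinomial (K : Type*) [Field K] {ι : Type*} (u v : ι →₀ ℕ) :
    MvPolynomial ι K :=
  monomial u 1 - monomial v 1

/-- The `A`-degree `∑ u_i a_i` of the monomial `x^u`, where `A = {a_i}`. -/
def degA {ι : Type*} [Fintype ι] (a : ι → ℕ) (u : ι →₀ ℕ) : ℕ :=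
  ∑ i, u i * a i

/-- The toric ideal `I_A`, generated by all `A`-homogeneous pure difference binomials. -/
noncomputable def toricIdeal (K : Type*) [Field K] {ι : Type*} [Fintype ι] (a : ι → ℕ) :
    Ideal (MvPolynomial ι K) :=
  Ideal.span {p | ∃ u v : ι →₀ ℕ, degA a u = degA a v ∧ p = pureBinomial K u v}

/-- The binomial `x^u - x^v` is irreducible: `u` and `v` have disjoint supports, and the nonzero
entries of `u + v` are relatively prime (zero entries do not affect the gcd). -/
def IsIrreducibleBinomial {ι : Type*} [Fintype ι] (u v : ι →₀ ℕ) : Prop :=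
  Disjoint u.support v.support ∧ Finset.univ.gcd (fun i => (u + v) i) = 1

/-- The set of circuits of `I_A`: the irreducible binomials of `I_A` such that no nonzero binomial
of `I_A` has strictly smaller support. -/
def circuits (K : Type*) [Field K] {ι : Type*} [Fintype ι] (a : ι → ℕ) :
    Set (MvPolynomial ι K) :=
  {p | ∃ u v : ι →₀ ℕ, p = pureBinomial K u v ∧ p ∈ toricIdeal K a ∧ IsIrreducibleBinomial u v ∧
    ¬ ∃ u' v' : ι →₀ ℕ, u' ≠ v' ∧ pureBinomial K u' v' ∈ toricIdeal K a ∧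
      (u'.support ∪ v'.support : Set ι) ⊂ (u.support ∪ v.support : Set ι)}

/-! ### Minimal generating sets of submonoids of `ℕ` -/

/-! Necessity: let `b` be the largest pairwise lcm of generators, attained by `a j` and `a k`. In
degrees below `b`, the only nontrivial circuits involve `x_i`, and they preserve the exponent of
`x_j` modulo `m = a i / gcd (a i) (a j)`. This gives a congruence whose ideal contains every
circuit. In degree `b - a i` there are two monomials whose `x_j`-exponents are `b / a j - m` and
`0`. If circuits generate, these agree modulo `m`, which forces `a i ∣ gcd (a i) (a j) * gcd (a i)
(a k)` (`dvd_gcd_mul_gcd_of_eq_span_circuits`). The pairwise gcds then serve as the `d`'s.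
Sufficiency: the circuits pairing `x_i` with `x_j` and with `x_k` reduce every monomial to exponents
below `d₂` at `j` and `d₃` at `k`, and such a normal form is determined by its degree
(`toricIdeal_eq_span_circuits`). Uniqueness of minimal generators identifies the given triple with
the `a l`. -/

theorem mem_closure_diff_singleton_of_lt {A : Set ℕ} {n x : ℕ}
    (hx : x ∈ AddSubmonoid.closure A) (hxn : x < n) :
    x ∈ AddSubmonoid.closure (A \ {n}) := by
  induction hx using AddSubmonoid.closure_induction with
  | mem y hy => exact AddSubmonoid.subset_closure ⟨hy, hxn.ne⟩
  | zero => exact zero_mem _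
  | add y z _ _ hy hz => exact add_mem (hy (by omega)) (hz (by omega))

theorem MinimallyGenerates.notMem_closure_diff {A : Set ℕ} {S : AddSubmonoid ℕ}
    (hA : MinimallyGenerates A S) {n : ℕ} (hn : n ∈ A) :
    n ∉ AddSubmonoid.closure (A \ {n}) := by
  intro h
  have hle : A ≤ A \ {n} := by
    refine hA.2 ?_ Set.sdiff_subset
    change AddSubmonoid.closure (A \ {n}) = S
    refine le_antisymm (hA.1 ▸ AddSubmonoid.closure_mono Set.sdiff_subset) ?_
    rw [← hA.1, AddSubmonoid.closure_le]
    intro x hx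
    by_cases hxn : x = n
    · exact hxn ▸ h
    · exact AddSubmonoid.subset_closure ⟨hx, hxn⟩
  exact (hle hn).2 rfl

/-- If `n ∈ A` were not in `B`, it would be a sum of elements of `B` smaller than `n`. Each of these
is a sum of elements of `A` other than `n`, so `n` would be redundant in `A`. -/
theorem MinimallyGenerates.subset {A B : Set ℕ} {S : AddSubmonoid ℕ}
    (hA : MinimallyGenerates A S) (hB : MinimallyGenerates B S) : A ⊆ B := by
  intro n hn
  by_contra hnB
  have key : ∀ x ∈ AddSubmonoid.closure B, x ≤ n → x ∈ AddSubmonoid.closure (A \ {n}) := by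
    intro x hx
    induction hx using AddSubmonoid.closure_induction with
    | mem y hy =>
      intro hyn
      refine mem_closure_diff_singleton_of_lt ?_ (lt_of_le_of_ne hyn fun h => hnB (h ▸ hy))
      rw [hA.1, ← hB.1]
      exact AddSubmonoid.subset_closure hy
    | zero => exact fun _ => zero_mem _
    | add y z _ _ hy hz => exact fun h => add_mem (hy (by omega)) (hz (by omega))
  refine hA.notMem_closure_diff hn (key n ?_ le_rfl)
  rw [hB.1, ← hA.1]
  exact AddSubmonoid.subset_closure hn

theorem MinimallyGenerates.unique {A B : Set ℕ} {S : AddSubmonoid ℕ}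
    (hA : MinimallyGenerates A S) (hB : MinimallyGenerates B S) : A = B :=
  (hA.subset hB).antisymm (hB.subset hA)

theorem MinimallyGenerates.pos {A : Set ℕ} {S : AddSubmonoid ℕ}
    (hA : MinimallyGenerates A S) {n : ℕ} (hn : n ∈ A) : 0 < n := by
  refine Nat.pos_of_ne_zero ?_
  rintro rfl
  exact hA.notMem_closure_diff hn (zero_mem _)

theorem IsNumericalSemigroup.eq_one_of_forall_dvd {S : AddSubmonoid ℕ}
    (hS : IsNumericalSemigroup S) {A : Set ℕ} (hA : AddSubmonoid.closure A = S) {d : ℕ}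
    (hd : ∀ n ∈ A, d ∣ n) : d = 1 := by
  obtain ⟨B, -, hgcd, hB⟩ := hS
  have key : ∀ x ∈ AddSubmonoid.closure A, d ∣ x := by
    intro x hx
    induction hx using AddSubmonoid.closure_induction with
    | mem y hy => exact hd y hy
    | zero => exact dvd_zero d
    | add y z _ _ hy hz => exact dvd_add hy hz
  refine Nat.dvd_one.mp (hgcd ▸ Finset.dvd_gcd fun b hb => key b ?_)
  rw [hA, ← hB]
  exact AddSubmonoid.subset_closure hb

/-! ### Ideals spanned by the binomials of a congruence -/

section Binomials

variable {K : Type*} [Field K] {ι : Type*}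

/-- The map to the monoid algebra of the quotient by `c` kills every generator, while distinct
classes remain distinct basis elements. -/
theorem AddCon.rel_of_pureBinomial_mem_span (c : AddCon (ι →₀ ℕ)) {u v : ι →₀ ℕ}
    (h : pureBinomial K u v ∈
      Ideal.span {p : MvPolynomial ι K | ∃ u v, c u v ∧ p = pureBinomial K u v}) : c u v := by
  let φ : MvPolynomial ι K →+* AddMonoidAlgebra K c.Quotient :=
    AddMonoidAlgebra.mapDomainRingHom K c.mk'
  have hφ : ∀ u v, φ (pureBinomial K u v) =
      AddMonoidAlgebra.single (u : c.Quotient) 1 - AddMonoidAlgebra.single (v : c.Quotient) 1 := by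
    intro u v
    rw [pureBinomial, map_sub, ← single_eq_monomial, ← single_eq_monomial]
    congr 1 <;> exact AddMonoidAlgebra.mapDomain_single
  have hle : Ideal.span {p : MvPolynomial ι K | ∃ u v, c u v ∧ p = pureBinomial K u v} ≤
      RingHom.ker φ := by
    rw [Ideal.span_le]
    rintro p ⟨u, v, huv, rfl⟩
    rw [SetLike.mem_coe, RingHom.mem_ker, hφ, (AddCon.eq c).mpr huv, sub_self]
  have h0 := hle h
  rw [RingHom.mem_ker, hφ, sub_eq_zero] at h0
  exact (AddCon.eq c).mp (AddMonoidAlgebra.single_left_injective one_ne_zero h0)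

theorem pureBinomial_add_right (u v w : ι →₀ ℕ) :
    pureBinomial K (u + w) (v + w) = pureBinomial K u v * monomial w 1 := by
  simp [pureBinomial, sub_mul, monomial_mul]

theorem pureBinomial_mem_trans {J : Ideal (MvPolynomial ι K)} {u v w : ι →₀ ℕ}
    (huv : pureBinomial K u v ∈ J) (hvw : pureBinomial K v w ∈ J) : pureBinomial K u w ∈ J := by
  have := J.add_mem huv hvw
  rwa [pureBinomial, pureBinomial, sub_add_sub_cancel] at this

theorem pureBinomial_mem_symm {J : Ideal (MvPolynomial ι K)} {u v : ι →₀ ℕ}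
    (huv : pureBinomial K u v ∈ J) : pureBinomial K v u ∈ J := by
  have := J.neg_mem huv
  rwa [pureBinomial, neg_sub] at this

variable [Fintype ι]

theorem degA_add (a : ι → ℕ) (u v : ι →₀ ℕ) : degA a (u + v) = degA a u + degA a v := by
  simp [degA, add_mul, Finset.sum_add_distrib]

theorem degA_single (a : ι → ℕ) (i : ι) (n : ℕ) : degA a (Finsupp.single i n) = n * a i := by
  classical
  simp [degA, Finsupp.single_apply, ite_mul]

/-- Exponents are congruent if they have the same degree and, in degrees below `b`, also the same
`j`-th coordinate modulo `m`. -/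
def truncatedDegreeCon (a : ι → ℕ) (j : ι) (b m : ℕ) : AddCon (ι →₀ ℕ) where
  r u v := degA a u = degA a v ∧ (degA a u < b → u j ≡ v j [MOD m])
  iseqv :=
    { refl := fun _ => ⟨rfl, fun _ => Nat.ModEq.rfl⟩
      symm := fun h => ⟨h.1.symm, fun hb => (h.2 (h.1 ▸ hb)).symm⟩
      trans := fun h h' => ⟨h.1.trans h'.1, fun hb => (h.2 hb).trans (h'.2 (h.1 ▸ hb))⟩ }
  -- A sum of degree below `b` has both summands of degree below `b`, so both congruences are
  -- available.
  add' := by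
    rintro u v w x ⟨h, hm⟩ ⟨h', hm'⟩
    refine ⟨by rw [degA_add, degA_add, h, h'], fun hb => ?_⟩
    rw [degA_add] at hb
    exact (hm (by omega)).add (hm' (by omega))

theorem pureBinomial_mem_toricIdeal_iff {a : ι → ℕ} {u v : ι →₀ ℕ} :
    pureBinomial K u v ∈ toricIdeal K a ↔ degA a u = degA a v := by
  refine ⟨fun h => ?_, fun h => Ideal.subset_span ⟨u, v, h, rfl⟩⟩
  let c : AddCon (ι →₀ ℕ) :=
    { r := fun u v => degA a u = degA a v
      iseqv := ⟨fun _ => rfl, Eq.symm, Eq.trans⟩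
      add' := fun h h' => by rw [degA_add, degA_add, h, h'] }
  exact c.rel_of_pureBinomial_mem_span h

theorem span_circuits_le_toricIdeal (a : ι → ℕ) :
    Ideal.span (circuits K a) ≤ toricIdeal K a := by
  rw [Ideal.span_le]
  rintro p ⟨u, v, -, hp, -⟩
  exact hp

end Binomials

/-! ### Three variables -/

section ThreeVariables

variable {K : Type*} [Field K] {a : Fin 3 → ℕ} {i j k : Fin 3}

theorem Fin.distinct_of_cover :
    ∀ {i j k : Fin 3}, (∀ l, l = i ∨ l = j ∨ l = k) → i ≠ j ∧ i ≠ k ∧ j ≠ k := by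
  decide

theorem degA_eq_of_cover (a : Fin 3 → ℕ) (hc : ∀ l, l = i ∨ l = j ∨ l = k) (u : Fin 3 →₀ ℕ) :
    degA a u = u i * a i + u j * a j + u k * a k := by
  obtain ⟨hij, hik, hjk⟩ := Fin.distinct_of_cover hc
  have huniv : (Finset.univ : Finset (Fin 3)) = {i, j, k} := by
    ext l
    simpa using hc l
  rw [degA, huniv, Finset.sum_insert (by simp [hij, hik]), Finset.sum_insert (by simp [hjk]),
    Finset.sum_singleton, add_assoc]

/-! ### Necessity: circuits in degrees below the largest lcm. -/

theorem exists_eq_zero_of_circuit (hpos : ∀ l, 0 < a l) {u v : Fin 3 →₀ ℕ}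
    (h : ¬ ∃ u' v' : Fin 3 →₀ ℕ, u' ≠ v' ∧ pureBinomial K u' v' ∈ toricIdeal K a ∧
      (u'.support ∪ v'.support : Set (Fin 3)) ⊂ (u.support ∪ v.support : Set (Fin 3))) :
    ∃ l, u l = 0 ∧ v l = 0 := by
  by_contra! hne
  have huniv : (u.support ∪ v.support : Set (Fin 3)) = Set.univ := by
    refine Set.eq_univ_of_forall fun l => ?_
    by_cases hl : u l = 0
    · exact Or.inr (by simpa using hne l hl)
    · exact Or.inl (by simpa using hl)
  refine h ⟨Finsupp.single 0 (a 1), Finsupp.single 1 (a 0), fun h => ?_, ?_, ?_⟩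
  · have := DFunLike.congr_fun h 0
    simp [(hpos 1).ne'] at this
  · rw [pureBinomial_mem_toricIdeal_iff, degA_single, degA_single, mul_comm]
  · rw [huniv, Set.ssubset_univ_iff, Set.ne_univ_iff_exists_notMem]
    exact ⟨2, by simp⟩

theorem circuits_subset_truncatedDegreeCon (hpos : ∀ l, 0 < a l)
    (hc : ∀ l, l = i ∨ l = j ∨ l = k) :
    circuits K a ⊆ {p | ∃ u v, truncatedDegreeCon a j ((a j).lcm (a k))
      (a i / (a i).gcd (a j)) u v ∧ p = pureBinomial K u v} := by
  rintro p ⟨u, v, rfl, hmem, -, hmin⟩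
  refine ⟨u, v, ?_, rfl⟩
  rw [pureBinomial_mem_toricIdeal_iff] at hmem
  refine ⟨hmem, fun hlt => ?_⟩
  rw [degA_eq_of_cover a hc, degA_eq_of_cover a hc] at hmem
  rw [degA_eq_of_cover a hc] at hlt
  have hmod : ∀ {l} {x y x' y' : ℕ}, x * a l + y * a j = x' * a l + y' * a j →
      y ≡ y' [MOD a l / (a l).gcd (a j)] := by
    intro l x y x' y' h
    refine Nat.ModEq.cancel_right_div_gcd (hpos l) ?_
    have := congrArg (· % a l) h
    simpa [Nat.ModEq, Nat.add_mod] using this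
  obtain ⟨l, hul, hvl⟩ := exists_eq_zero_of_circuit hpos hmin
  rcases hc l with rfl | rfl | rfl
  -- Only `x_j` and `x_k` occur. Degree below the lcm puts both exponents at `j` below `a k / gcd (a
  -- k) (a j)`, modulo which they agree, so they are equal.
  · rw [hul, hvl, zero_mul, zero_add, zero_add] at hmem
    rw [hul, zero_mul, zero_add] at hlt
    have hb : (a j).lcm (a k) = a k / (a k).gcd (a j) * a j := by
      rw [Nat.lcm_comm, Nat.lcm, Nat.div_mul_right_comm (Nat.gcd_dvd_left _ _)]
    have hjk : u j ≡ v j [MOD a k / (a k).gcd (a j)] :=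
      hmod (x := u k) (x' := v k) (by omega)
    rw [hjk.eq_of_lt_of_lt (lt_of_mul_lt_mul_right (a := a j) (by omega) (Nat.zero_le _))
      (lt_of_mul_lt_mul_right (a := a j) (by omega) (Nat.zero_le _))]
  · rw [hul, hvl]
  · rw [hul, hvl, zero_mul, add_zero, add_zero] at hmem
    exact hmod hmem

/-- If the circuits generate and `x_j`, `x_k` form the pair with the largest circuit degree, then
`a i` divides the product of its greatest common divisors with `a j` and `a k`. -/
theorem dvd_gcd_mul_gcd_of_eq_span_circuits (hpos : ∀ l, 0 < a l)
    (hc : ∀ l, l = i ∨ l = j ∨ l = k) (hgen : toricIdeal K a = Ideal.span (circuits K a))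
    (hij : (a i).lcm (a j) ≤ (a j).lcm (a k)) (hik : (a i).lcm (a k) ≤ (a j).lcm (a k)) :
    a i ∣ (a i).gcd (a j) * (a i).gcd (a k) := by
  obtain ⟨nij, nik, njk⟩ := Fin.distinct_of_cover hc
  set b := (a j).lcm (a k) with hb
  have hgj : 0 < (a i).gcd (a j) := Nat.gcd_pos_of_pos_left _ (hpos i)
  have hgk : 0 < (a i).gcd (a k) := Nat.gcd_pos_of_pos_left _ (hpos i)
  obtain ⟨s, hs⟩ : a j ∣ b := Nat.dvd_lcm_left _ _
  obtain ⟨t, ht⟩ : a k ∣ b := Nat.dvd_lcm_right _ _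
  obtain ⟨m, hm⟩ := Nat.gcd_dvd_left (a i) (a j)
  obtain ⟨p, hp⟩ := Nat.gcd_dvd_right (a i) (a j)
  obtain ⟨n, hn⟩ := Nat.gcd_dvd_left (a i) (a k)
  obtain ⟨q, hq⟩ := Nat.gcd_dvd_right (a i) (a k)
  have hmdef : a i / (a i).gcd (a j) = m := Nat.div_eq_of_eq_mul_right hgj hm
  have hmp : m * a j = p * a i := by
    refine Nat.eq_of_mul_eq_mul_left hgj ?_
    linear_combination (a i) * hp - (a j) * hm
  have hnq : n * a k = q * a i := by
    refine Nat.eq_of_mul_eq_mul_left hgk ?_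
    linear_combination (a i) * hq - (a k) * hn
  have hlij : (a i).lcm (a j) = m * a j := by
    refine Nat.eq_of_mul_eq_mul_left hgj ?_
    rw [Nat.gcd_mul_lcm, ← mul_assoc, ← hm]
  have hlik : (a i).lcm (a k) = n * a k := by
    refine Nat.eq_of_mul_eq_mul_left hgk ?_
    rw [Nat.gcd_mul_lcm, ← mul_assoc, ← hn]
  have hms : m ≤ s := by
    refine le_of_mul_le_mul_right (a := a j) ?_ (hpos j)
    rw [← hlij, mul_comm s, ← hs]
    exact hij
  have hnt : n ≤ t := by
    refine le_of_mul_le_mul_right (a := a k) ?_ (hpos k)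
    rw [← hlik, mul_comm t, ← ht]
    exact hik
  have hp0 : p ≠ 0 := by
    rintro rfl
    exact (hpos j).ne' (by rw [hp, mul_zero])
  have hq0 : q ≠ 0 := by
    rintro rfl
    exact (hpos k).ne' (by rw [hq, mul_zero])
  obtain ⟨p, rfl⟩ := Nat.exists_eq_add_one_of_ne_zero hp0
  obtain ⟨q, rfl⟩ := Nat.exists_eq_add_one_of_ne_zero hq0
  obtain ⟨s, rfl⟩ := Nat.exists_eq_add_of_le hms
  obtain ⟨t, rfl⟩ := Nat.exists_eq_add_of_le hnt
  -- In degree `b`, trade `x_j ^ m` for `x_i ^ (p + 1)` in the pure power of `x_j`, and `x_k ^ n`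
  -- for `x_i ^ (q + 1)` in that of `x_k`. Cancelling one common `x_i` gives `u` and `v`, of degree
  -- `b - a i`, strictly below `b`.
  let u := Finsupp.single i p + Finsupp.single j s
  let v := Finsupp.single i q + Finsupp.single k t
  have hu : degA a u + a i = b := by
    rw [degA_add, degA_single, degA_single]
    linear_combination -hs - hmp
  have hv : degA a v + a i = b := by
    rw [degA_add, degA_single, degA_single]
    linear_combination -ht - hnq
  have huv : pureBinomial K u v ∈ toricIdeal K a :=
    pureBinomial_mem_toricIdeal_iff.mpr (by omega)
  rw [hgen] at huv
  have hmod : s ≡ 0 [MOD m] := by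
    have := ((truncatedDegreeCon a j b (a i / (a i).gcd (a j))).rel_of_pureBinomial_mem_span
      (Ideal.span_mono (circuits_subset_truncatedDegreeCon hpos hc) huv)).2
        (by have := hpos i; omega)
    simpa [u, v, hmdef, Finsupp.single_apply, nij, nik, njk, njk.symm] using this
  have hms : m ∣ m + s := dvd_add dvd_rfl (Nat.modEq_zero_iff_dvd.mp hmod)
  have hsk : m + s ∣ a k := by
    refine Nat.dvd_of_mul_dvd_mul_left (hpos j) ?_
    rw [← hs]
    exact Nat.lcm_dvd_mul _ _
  have hmk : m ∣ (a i).gcd (a k) := Nat.dvd_gcd (Dvd.intro_left _ hm.symm) (hms.trans hsk)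
  nth_rewrite 1 [hm]
  exact Nat.mul_dvd_mul_left _ hmk

/-! ### Sufficiency: normal forms modulo two circuits. -/

/-- Up to sign, the circuits are the binomials supported on two variables with coprime
exponents. -/
theorem pureBinomial_single_mem_circuits (hpos : ∀ l, 0 < a l) (hij : i ≠ j) {x y : ℕ}
    (hdeg : x * a i = y * a j) (hxy : x.Coprime y) :
    pureBinomial K (Finsupp.single i x) (Finsupp.single j y) ∈ circuits K a := by
  refine ⟨_, _, rfl, ?_, ⟨?_, ?_⟩, ?_⟩
  · rw [pureBinomial_mem_toricIdeal_iff, degA_single, degA_single, hdeg]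
  · exact (Finset.disjoint_singleton.mpr hij).mono Finsupp.support_single_subset
      Finsupp.support_single_subset
  · refine Nat.dvd_one.mp (hxy ▸ Nat.dvd_gcd ?_ ?_)
    · refine (Finset.gcd_dvd (Finset.mem_univ i)).trans (dvd_of_eq ?_)
      simp [hij.symm]
    · refine (Finset.gcd_dvd (Finset.mem_univ j)).trans (dvd_of_eq ?_)
      simp [hij]
  · rintro ⟨u, v, huv, hmem, hsub⟩
    rw [pureBinomial_mem_toricIdeal_iff] at hmem
    obtain ⟨hle, hnle⟩ := hsub
    have hpair : ((Finsupp.single i x).support ∪ (Finsupp.single j y).support : Set (Fin 3)) ⊆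
        {i, j} := by
      refine Set.union_subset ?_ ?_ <;> intro l hl <;>
        have := Finsupp.support_single_subset (Finset.mem_coe.mp hl) <;> simp_all
    -- A proper subset of `{i, j}` leaves one variable, where equal degree means equal exponent.
    obtain ⟨l, hl⟩ : ∃ l, ∀ l', l' ≠ l → u l' = 0 ∧ v l' = 0 := by
      obtain ⟨l', hl', hl'uv⟩ := Set.not_subset.mp hnle
      have hout : ∀ l ∉ (u.support ∪ v.support : Set (Fin 3)), u l = 0 ∧ v l = 0 := by
        intro l hl
        simpa using hl
      have hother : ∀ l, l ≠ i → l ≠ j → u l = 0 ∧ v l = 0 := by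
        intro l hli hlj
        refine hout l fun hl => ?_
        rcases hpair (hle hl) with h | h
        exacts [hli h, hlj h]
      rcases hpair hl' with rfl | rfl
      · refine ⟨j, fun l hl => ?_⟩
        by_cases hli : l = l'
        exacts [hli ▸ hout l' hl'uv, hother l hli hl]
      · refine ⟨i, fun l hl => ?_⟩
        by_cases hlj : l = l'
        exacts [hlj ▸ hout l' hl'uv, hother l hl hlj]
    have hdeg' : ∀ w : Fin 3 →₀ ℕ, (∀ l', l' ≠ l → w l' = 0) → degA a w = w l * a l := by
      intro w hw
      exact Finset.sum_eq_single l (fun l' _ h => by rw [hw l' h, zero_mul]) (by simp)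
    rw [hdeg' u fun l' h => (hl l' h).1, hdeg' v fun l' h => (hl l' h).2] at hmem
    refine huv (Finsupp.ext fun l' => ?_)
    by_cases h : l' = l
    · exact h ▸ Nat.eq_of_mul_eq_mul_right (hpos l) hmem
    · rw [(hl l' h).1, (hl l' h).2]

/-- Modulo `x_j ^ y - x_i ^ x`, every monomial is congruent to one whose exponent at `j` is
below `y`. -/
theorem exists_reduced_pureBinomial_mem {J : Ideal (MvPolynomial (Fin 3) K)} (hij : i ≠ j)
    {x y : ℕ} (hy : 0 < y) (hJ : pureBinomial K (Finsupp.single i x) (Finsupp.single j y) ∈ J)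
    (u : Fin 3 →₀ ℕ) :
    ∃ v : Fin 3 →₀ ℕ, pureBinomial K u v ∈ J ∧ v j < y ∧ ∀ l, l ≠ i → l ≠ j → v l = u l := by
  induction hn : u j using Nat.strong_induction_on generalizing u with
  | _ n ih =>
    subst hn
    by_cases h : u j < y
    · exact ⟨u, by simp [pureBinomial], h, fun _ _ _ => rfl⟩
    · push Not at h
      have hu : Finsupp.single j y + (u - Finsupp.single j y) = u :=
        add_tsub_cancel_of_le (Finsupp.single_le_iff.mpr h)
      set w := u - Finsupp.single j y
      have hwj : y + w j = u j := by
        simpa using DFunLike.congr_fun hu j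
      have hstep : pureBinomial K u (Finsupp.single i x + w) ∈ J := by
        nth_rewrite 1 [← hu]
        rw [pureBinomial_add_right]
        exact J.mul_mem_right _ (pureBinomial_mem_symm hJ)
      have hj : (Finsupp.single i x + w) j = w j := by
        simp [hij]
      obtain ⟨v, hv, hvj, hvl⟩ := ih _ (by omega) (Finsupp.single i x + w) hj
      refine ⟨v, pureBinomial_mem_trans hstep hv, hvj, fun l hli hlj => ?_⟩
      rw [hvl l hli hlj, ← hu]
      simp [hli.symm, hlj.symm]

theorem toricIdeal_eq_span_circuits (hpos : ∀ l, 0 < a l) (hc : ∀ l, l = i ∨ l = j ∨ l = k)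
    {d₁ d₂ d₃ f₂ f₃ : ℕ} (h₁₂ : d₁.Coprime d₂) (h₁₃ : d₁.Coprime d₃) (h₂₃ : d₂.Coprime d₃)
    (hf₂ : d₂.Coprime f₂) (hf₃ : d₃.Coprime f₃) (hi : a i = d₂ * d₃)
    (hj : a j = f₂ * d₁ * d₃) (hk : a k = f₃ * d₁ * d₂) :
    toricIdeal K a = Ideal.span (circuits K a) := by
  obtain ⟨nij, nik, njk⟩ := Fin.distinct_of_cover hc
  refine le_antisymm ?_ (span_circuits_le_toricIdeal a)
  have hd₂ : 0 < d₂ := Nat.pos_of_mul_pos_right (hi ▸ hpos i)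
  have hd₃ : 0 < d₃ := Nat.pos_of_mul_pos_left (hi ▸ hpos i)
  have hcij := Ideal.subset_span (pureBinomial_single_mem_circuits (K := K) hpos nij
    (x := f₂ * d₁) (y := d₂) (by rw [hi, hj]; ring) (hf₂.symm.mul_left h₁₂))
  have hcik := Ideal.subset_span (pureBinomial_single_mem_circuits (K := K) hpos nik
    (x := f₃ * d₁) (y := d₃) (by rw [hi, hk]; ring) (hf₃.symm.mul_left h₁₃))
  have hred : ∀ u : Fin 3 →₀ ℕ, ∃ v : Fin 3 →₀ ℕ,
      pureBinomial K u v ∈ Ideal.span (circuits K a) ∧ v j < d₂ ∧ v k < d₃ := by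
    intro u
    obtain ⟨v, huv, hvj, -⟩ := exists_reduced_pureBinomial_mem nij hd₂ hcij u
    obtain ⟨w, hvw, hwk, hw⟩ := exists_reduced_pureBinomial_mem nik hd₃ hcik v
    exact ⟨w, pureBinomial_mem_trans huv hvw, (hw j nij.symm njk).symm ▸ hvj, hwk⟩
  have hdeg : ∀ {u v : Fin 3 →₀ ℕ}, pureBinomial K u v ∈ Ideal.span (circuits K a) →
      degA a u = degA a v := fun h =>
    pureBinomial_mem_toricIdeal_iff.mp (span_circuits_le_toricIdeal a h)
  rw [toricIdeal, Ideal.span_le]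
  rintro p ⟨u, v, huv, rfl⟩
  obtain ⟨u', hu, huj, huk⟩ := hred u
  obtain ⟨v', hv, hvj, hvk⟩ := hred v
  have heq : degA a u' = degA a v' := by rw [← hdeg hu, huv, hdeg hv]
  rw [degA_eq_of_cover a hc, degA_eq_of_cover a hc] at heq
  have hjj : u' j = v' j := by
    refine Nat.ModEq.eq_of_lt_of_lt (m := d₂) ?_ huj hvj
    -- Modulo `d₂`, the terms at `i` and `k` vanish and `a j` is a unit.
    have hcop : d₂.gcd (a j) = 1 := hj ▸ (hf₂.mul_right h₁₂.symm).mul_right h₂₃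
    refine Nat.ModEq.cancel_right_of_coprime hcop ?_
    have := congrArg (· % d₂) heq
    simpa [Nat.ModEq, Nat.add_mod, Nat.mul_mod, hi, hk] using this
  have hkk : u' k = v' k := by
    refine Nat.ModEq.eq_of_lt_of_lt (m := d₃) ?_ huk hvk
    have hcop : d₃.gcd (a k) = 1 := hk ▸ (hf₃.mul_right h₁₃.symm).mul_right h₂₃.symm
    refine Nat.ModEq.cancel_right_of_coprime hcop ?_
    have := congrArg (· % d₃) heq
    simpa [Nat.ModEq, Nat.add_mod, Nat.mul_mod, hi, hj] using this
  have hii : u' i = v' i := by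
    rw [hjj, hkk] at heq
    exact Nat.eq_of_mul_eq_mul_right (hpos i) (by omega)
  have huv' : u' = v' := by
    ext l
    rcases hc l with rfl | rfl | rfl
    exacts [hii, hjj, hkk]
  subst huv'
  exact pureBinomial_mem_trans hu (pureBinomial_mem_symm hv)

/-! ### Arithmetic of the pairwise gcds. -/

theorem exists_factorization_of_dvd_gcd_mul_gcd (hpos : ∀ l, 0 < a l)
    (hc : ∀ l, l = i ∨ l = j ∨ l = k) (hgcd : ∀ d, (∀ l, d ∣ a l) → d = 1)
    (hdvd : a i ∣ (a i).gcd (a j) * (a i).gcd (a k)) :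
    ∃ d₁ d₂ d₃ f₂ f₃ : ℕ,
      0 < d₁ ∧ 0 < d₂ ∧ 0 < d₃ ∧ 0 < f₂ ∧ 0 < f₃ ∧
      Nat.Coprime d₁ d₂ ∧ Nat.Coprime d₁ d₃ ∧ Nat.Coprime d₂ d₃ ∧
      Nat.gcd d₂ f₂ = 1 ∧ Nat.gcd d₃ f₃ = 1 ∧
      a i = d₂ * d₃ ∧ a j = f₂ * d₁ * d₃ ∧ a k = f₃ * d₁ * d₂ := by
  have hone : ∀ d, d ∣ a i → d ∣ a j → d ∣ a k → d = 1 := by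
    intro d h₁ h₂ h₃
    refine hgcd d fun l => ?_
    rcases hc l with rfl | rfl | rfl <;> assumption
  set d₁ := (a j).gcd (a k) with hd₁
  set d₂ := (a i).gcd (a k) with hd₂
  set d₃ := (a i).gcd (a j) with hd₃
  have h₁j : d₁ ∣ a j := Nat.gcd_dvd_left _ _
  have h₁k : d₁ ∣ a k := Nat.gcd_dvd_right _ _
  have h₂i : d₂ ∣ a i := Nat.gcd_dvd_left _ _
  have h₂k : d₂ ∣ a k := Nat.gcd_dvd_right _ _
  have h₃i : d₃ ∣ a i := Nat.gcd_dvd_left _ _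
  have h₃j : d₃ ∣ a j := Nat.gcd_dvd_right _ _
  have h₁₂ : d₁.Coprime d₂ := hone _ ((Nat.gcd_dvd_right _ _).trans h₂i)
    ((Nat.gcd_dvd_left _ _).trans h₁j) ((Nat.gcd_dvd_left _ _).trans h₁k)
  have h₁₃ : d₁.Coprime d₃ := hone _ ((Nat.gcd_dvd_right _ _).trans h₃i)
    ((Nat.gcd_dvd_left _ _).trans h₁j) ((Nat.gcd_dvd_left _ _).trans h₁k)
  have h₂₃ : d₂.Coprime d₃ := hone _ ((Nat.gcd_dvd_right _ _).trans h₃i)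
    ((Nat.gcd_dvd_right _ _).trans h₃j) ((Nat.gcd_dvd_left _ _).trans h₂k)
  have hi : a i = d₂ * d₃ :=
    Nat.dvd_antisymm (by rwa [mul_comm]) (h₂₃.mul_dvd_of_dvd_of_dvd h₂i h₃i)
  obtain ⟨f₂, hf₂⟩ := h₁₃.mul_dvd_of_dvd_of_dvd h₁j h₃j
  obtain ⟨f₃, hf₃⟩ := h₁₂.mul_dvd_of_dvd_of_dvd h₁k h₂k
  have hp₂ : 0 < d₂ := Nat.gcd_pos_of_pos_left _ (hpos i)
  have hp₃ : 0 < d₃ := Nat.gcd_pos_of_pos_left _ (hpos i)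
  have hg₂ : Nat.gcd d₂ f₂ = 1 := by
    -- `d₃ * gcd d₂ f₂` divides both `a i` and `a j`, hence their gcd `d₃`.
    refine Nat.dvd_one.mp (Nat.dvd_of_mul_dvd_mul_left hp₃ ?_)
    rw [mul_one]
    refine Nat.dvd_gcd ?_ ?_
    · rw [hi, mul_comm d₂]
      exact Nat.mul_dvd_mul_left _ (Nat.gcd_dvd_left _ _)
    · rw [hf₂, mul_comm d₁, mul_assoc]
      exact Nat.mul_dvd_mul_left _ ((Nat.gcd_dvd_right _ _).trans (Nat.dvd_mul_left _ _))
  have hg₃ : Nat.gcd d₃ f₃ = 1 := by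
    refine Nat.dvd_one.mp (Nat.dvd_of_mul_dvd_mul_left hp₂ ?_)
    rw [mul_one]
    refine Nat.dvd_gcd ?_ ?_
    · rw [hi]
      exact Nat.mul_dvd_mul_left _ (Nat.gcd_dvd_left _ _)
    · rw [hf₃, mul_comm d₁, mul_assoc]
      exact Nat.mul_dvd_mul_left _ ((Nat.gcd_dvd_right _ _).trans (Nat.dvd_mul_left _ _))
  exact ⟨d₁, d₂, d₃, f₂, f₃, Nat.gcd_pos_of_pos_left _ (hpos j), hp₂, hp₃,
    Nat.pos_of_mul_pos_left (hf₂ ▸ hpos j), Nat.pos_of_mul_pos_left (hf₃ ▸ hpos k),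
    h₁₂, h₁₃, h₂₃, hg₂, hg₃, hi, by rw [hf₂]; ring, by rw [hf₃]; ring⟩

theorem exists_cover_dvd_gcd_mul_gcd (hpos : ∀ l, 0 < a l)
    (hgen : toricIdeal K a = Ideal.span (circuits K a)) :
    ∃ i j k : Fin 3, (∀ l, l = i ∨ l = j ∨ l = k) ∧
      a i ∣ (a i).gcd (a j) * (a i).gcd (a k) := by
  have h₀₁ := Nat.lcm_comm (a 0) (a 1)
  have h₀₂ := Nat.lcm_comm (a 0) (a 2)
  have h₁₂ := Nat.lcm_comm (a 1) (a 2)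
  have hcov : (∀ l : Fin 3, l = 0 ∨ l = 1 ∨ l = 2) ∧ (∀ l : Fin 3, l = 1 ∨ l = 0 ∨ l = 2) ∧
      ∀ l : Fin 3, l = 2 ∨ l = 0 ∨ l = 1 := by decide
  have hmax : ((a 0).lcm (a 1) ≤ (a 1).lcm (a 2) ∧ (a 0).lcm (a 2) ≤ (a 1).lcm (a 2)) ∨
      ((a 1).lcm (a 0) ≤ (a 0).lcm (a 2) ∧ (a 1).lcm (a 2) ≤ (a 0).lcm (a 2)) ∨
      ((a 2).lcm (a 0) ≤ (a 0).lcm (a 1) ∧ (a 2).lcm (a 1) ≤ (a 0).lcm (a 1)) := by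
    omega
  rcases hmax with h | h | h
  · exact ⟨0, 1, 2, hcov.1, dvd_gcd_mul_gcd_of_eq_span_circuits hpos hcov.1 hgen h.1 h.2⟩
  · exact ⟨1, 0, 2, hcov.2.1, dvd_gcd_mul_gcd_of_eq_span_circuits hpos hcov.2.1 hgen h.1 h.2⟩
  · exact ⟨2, 0, 1, hcov.2.2, dvd_gcd_mul_gcd_of_eq_span_circuits hpos hcov.2.2 hgen h.1 h.2⟩

theorem range_eq_of_cover {α : Type*} (a : Fin 3 → α) (hc : ∀ l, l = i ∨ l = j ∨ l = k) :
    Set.range a = {a i, a j, a k} := by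
  ext x
  constructor
  · rintro ⟨l, rfl⟩
    rcases hc l with rfl | rfl | rfl <;> simp
  · rintro (rfl | rfl | rfl) <;> exact Set.mem_range_self _

end ThreeVariables

theorem proposition3p14 (K : Type*) [Field K] (S : AddSubmonoid ℕ) (hS : IsNumericalSemigroup S)
    (a : Fin 3 → ℕ) (ha : Function.Injective a) (hgen : MinimallyGenerates (Set.range a) S) :
    toricIdeal K a = Ideal.span (circuits K a) ↔
      ∃ d₁ d₂ d₃ f₂ f₃ : ℕ,
        0 < d₁ ∧ 0 < d₂ ∧ 0 < d₃ ∧ 0 < f₂ ∧ 0 < f₃ ∧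
        Nat.Coprime d₁ d₂ ∧ Nat.Coprime d₁ d₃ ∧ Nat.Coprime d₂ d₃ ∧
        Nat.gcd d₂ f₂ = 1 ∧ Nat.gcd d₃ f₃ = 1 ∧
        MinimallyGenerates {d₂ * d₃, f₂ * d₁ * d₃, f₃ * d₁ * d₂} S := by
  have hpos : ∀ l, 0 < a l := fun l => hgen.pos (Set.mem_range_self l)
  constructor
  · intro h
    obtain ⟨i, j, k, hc, hdvd⟩ := exists_cover_dvd_gcd_mul_gcd hpos h
    have hgcd : ∀ d, (∀ l, d ∣ a l) → d = 1 := fun d hd =>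
      hS.eq_one_of_forall_dvd hgen.1 (by rintro _ ⟨l, rfl⟩; exact hd l)
    obtain ⟨d₁, d₂, d₃, f₂, f₃, h₁, h₂, h₃, h₄, h₅, h₆, h₇, h₈, h₉, h₁₀, hi, hj, hk⟩ :=
      exists_factorization_of_dvd_gcd_mul_gcd hpos hc hgcd hdvd
    refine ⟨d₁, d₂, d₃, f₂, f₃, h₁, h₂, h₃, h₄, h₅, h₆, h₇, h₈, h₉, h₁₀, ?_⟩
    rwa [← hi, ← hj, ← hk, ← range_eq_of_cover a hc]
  · rintro ⟨d₁, d₂, d₃, f₂, f₃, -, -, -, -, -, h₁₂, h₁₃, h₂₃, hf₂, hf₃, hmin⟩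
    have hrange := hgen.unique hmin
    obtain ⟨i, hi⟩ : d₂ * d₃ ∈ Set.range a := hrange ▸ Or.inl rfl
    obtain ⟨j, hj⟩ : f₂ * d₁ * d₃ ∈ Set.range a := hrange ▸ Or.inr (Or.inl rfl)
    obtain ⟨k, hk⟩ : f₃ * d₁ * d₂ ∈ Set.range a := hrange ▸ Or.inr (Or.inr rfl)
    have hc : ∀ l, l = i ∨ l = j ∨ l = k := by
      intro l
      have hl : a l ∈ ({d₂ * d₃, f₂ * d₁ * d₃, f₃ * d₁ * d₂} : Set ℕ) :=
        hrange ▸ Set.mem_range_self l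
      rw [← hi, ← hj, ← hk] at hl
      exact hl.imp (ha ·) (Or.imp (ha ·) (ha ·))
    exact toricIdeal_eq_span_circuits hpos hc h₁₂ h₁₃ h₂₃ hf₂ hf₃ hi hj hk
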